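/- All graphs are finite and simple, and hypergraphs have no repeated hyperedges. Let $F$ be a graph with at least one edge. For $n\ge 0$ let $\mathrm{ex}(n,K_3,F)$ be the maximum number of triangles in an $n$-vertex graph that contains no (not necessarily induced) subgraph isomorphic to $F$. A hypergraph $\mathcal H$ is a Berge copy of $F$ if there are an injection $\varphi:V(F)\to V(\mathcal H)$ and a bijection $f:E(F)\to E(\mathcal H)$ such that $\{\varphi(u),\varphi(v)\}\subseteq f(uv)$ for every edge $uv$ of $F$. Let $\mathrm{ex}_r(n,\text{Berge-}F)$ be the maximum number of hyperedges in an $r$-uniform $n$-vertex hypergraph no subhypergraph of which is a Berge copy of $F$. The uniformity threshold $\mathrm{th}(F)$ is the smallest integer $r_0\ge 2$ such that for every $r\ge r_0$ we have $\mathrm{ex}_r(n,\text{Berge-}F)=o(n^2)$ as $n\to\infty$. If $\mathrm{ex}(n,K_3,F)=o(n^2)$ as $n\to\infty$, then $$\mathrm{th}(F)\le (\chi(F)-1)(|V(F)|-1)+1,$$ where $\chi(F)$ is the chromatic number of $F$. -/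

import Mathlib

open Asymptotics Filter

/-- The generalized Turán number `ex(n, H, F)`: the maximum number of copies of `H` (subgraphs
isomorphic to `H`) in an `F`-free graph on `n` vertices. -/
noncomputable def generalizedTuran {W V : Type*} (n : ℕ) (H : SimpleGraph W)
    (F : SimpleGraph V) : ℕ :=
  open scoped Classical in
  ({G : SimpleGraph (Fin n) | F.Free G} : Finset (SimpleGraph (Fin n))).sup
    fun G => G.copyCount H

/-- A hypergraph on vertex set `α`, given by its set `𝓗` of hyperedges, is a Berge copy of `F`:
after embedding `V(F)` into `α` there is a bijection from the edges of `F` to the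
hyperedges such that each edge is contained in its image. -/
def IsBergeCopy {V α : Type*} (F : SimpleGraph V) (𝓗 : Finset (Finset α)) : Prop :=
  ∃ (φ : V ↪ α) (f : F.edgeSet ≃ 𝓗), ∀ (e : F.edgeSet) (v : V), v ∈ e.1 → φ v ∈ (f e).1

/-- A hypergraph is Berge-`F`-free if no subhypergraph of it is a Berge copy of `F`. -/
def BergeFree {V α : Type*} (F : SimpleGraph V) (𝓗 : Finset (Finset α)) : Prop :=
  ∀ 𝓗' ⊆ 𝓗, ¬ IsBergeCopy F 𝓗'

/-- `ex_r(n, Berge-F)`: the maximum number of hyperedges in an `r`-uniform Berge-`F`-free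
hypergraph on `n` vertices. -/
noncomputable def exBerge {V : Type*} (r n : ℕ) (F : SimpleGraph V) : ℕ :=
  open scoped Classical in
  ({𝓗 : Finset (Finset (Fin n)) | (𝓗 : Set (Finset (Fin n))).Sized r ∧ BergeFree F 𝓗} :
    Finset (Finset (Finset (Fin n)))).sup Finset.card

/-- The uniformity threshold `th(F)`: the smallest integer `r₀ ≥ 2` such that
`ex_r(n, Berge-F) = o(n²)` for every `r ≥ r₀`. It is `⊤` if there is no such `r₀`. -/
noncomputable def uniformityThreshold {V : Type*} (F : SimpleGraph V) : ℕ∞ :=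
  sInf {k : ℕ∞ | ∃ r₀ : ℕ, k = r₀ ∧ 2 ≤ r₀ ∧
    ∀ r ≥ r₀, (fun n : ℕ => (exBerge r n F : ℝ)) =o[atTop] fun n : ℕ => (n : ℝ) ^ 2}

/-! Let `𝓗` be `r`-uniform and Berge-`F`-free, and call a pair of vertices heavy if it lies in at
least `k = e(F)` hyperedges, light otherwise. A maximal subfamily `𝓢` whose members pairwise share
only heavy pairs contains a positive proportion of `𝓗`, so it suffices to bound `𝓢`. The engine is
`BergeFree.free_heavyGraph_sup`: the heavy pairs together with one chosen pair from each member of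
`𝓢` form an `F`-free graph, because Hall's theorem would turn a copy of `F` into a Berge copy.

If a hyperedge contains heavy pairs `uv`, `vw` and a light pair `uw`, choosing `uw` creates a
triangle that determines the hyperedge. Hence there are at most `ex(n, K₃, F) = o(n²)` such
hyperedges.

In any other hyperedge heaviness is transitive, so it splits into heavy cliques, each with fewer
than `|V(F)|` vertices. If `χ(F) = 2`, size at least `|V(F)|` gives a light pair. These pairs are
distinct for distinct hyperedges and form an `F`-free graph, so Kővári–Sós–Turán applies. If `χ(F) ≥
3`, size above `2(|V(F)| - 1)` gives a light triple. These triples are edge-disjoint triangles; if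
there were `εn²` of them, triangle removal would give `δn³` triangles in their union. A random
choice of one pair per triple keeps 1/27 of the triangles other than the triples themselves, on
average, which is too many for an `F`-free graph. -/

/-! ### Heavy pairs and Hall's theorem -/

/-- The graph of pairs of vertices that lie in at least `k` hyperedges of `𝓗`. -/
def heavyGraph {α : Type*} [DecidableEq α] (𝓗 : Finset (Finset α)) (k : ℕ) : SimpleGraph α where
  Adj u v := u ≠ v ∧ k ≤ (𝓗.filter fun A => u ∈ A ∧ v ∈ A).card
  symm := ⟨fun u v h => ⟨h.1.symm, by simpa only [and_comm] using h.2⟩⟩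
  loopless := ⟨fun _ h => h.1 rfl⟩

/-- The heavy pairs of a Berge-`F`-free hypergraph, together with one pair from every hyperedge,
form an `F`-free graph. -/
theorem BergeFree.free_heavyGraph_sup {V α : Type*} [Fintype V] [DecidableEq α]
    {F : SimpleGraph V} {𝓗 : Finset (Finset α)} (h𝓗 : BergeFree F 𝓗)
    {𝓢 : Finset (Finset α)} (h𝓢 : 𝓢 ⊆ 𝓗) (p : Finset α → Sym2 α)
    (hp : ∀ A ∈ 𝓢, ∀ v ∈ p A, v ∈ A) :
    F.Free (heavyGraph 𝓗 (Nat.card F.edgeSet) ⊔ SimpleGraph.fromEdgeSet (p '' 𝓢)) := by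
  classical
  rintro ⟨φ⟩
  let t : F.edgeSet → Finset (Finset α) := fun e => 𝓗.filter fun A => ∀ v ∈ e.1, φ v ∈ A
  have key : ∀ e : F.edgeSet, Nat.card F.edgeSet ≤ (t e).card ∨
      ∃ A ∈ 𝓢, p A = Sym2.map φ e.1 := by
    rintro ⟨e, he⟩
    induction e with | _ u v
    rcases (φ.toHom.map_adj he : (_ ⊔ _ : SimpleGraph α).Adj (φ u) (φ v)) with h | h
    · left
      refine h.2.trans (Finset.card_le_card ?_)
      intro A hA
      have hA : A ∈ 𝓗 ∧ φ u ∈ A ∧ φ v ∈ A := Finset.mem_filter.1 hA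
      simpa [t] using hA
    · right
      rw [SimpleGraph.fromEdgeSet_adj] at h
      obtain ⟨A, hA, hpA⟩ := h.1
      exact ⟨A, hA, hpA⟩
  -- Hall's condition: a set of edges with a heavy member sees at least `e(F)` hyperedges. Otherwise
  -- each edge is the chosen pair of some hyperedge, and different edges have different hyperedges.
  obtain ⟨f, hf, hft⟩ := (Finset.all_card_le_biUnion_card_iff_exists_injective t).1 (by
    intro s
    by_cases hs : ∃ e ∈ s, Nat.card F.edgeSet ≤ (t e).card
    · obtain ⟨e, hes, he⟩ := hs
      calc s.card ≤ Nat.card F.edgeSet := by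
            rw [Nat.card_eq_fintype_card]; exact s.card_le_univ
        _ ≤ _ := he.trans (Finset.card_le_card (Finset.subset_biUnion_of_mem t hes))
    · push Not at hs
      have h1 : ∀ e : F.edgeSet, ∃ A, e ∈ s → A ∈ 𝓢 ∧ p A = Sym2.map φ e.1 := by
        intro e
        by_cases hes : e ∈ s
        · obtain ⟨A, hA⟩ := (key e).resolve_left (hs e hes).not_ge
          exact ⟨A, fun _ => hA⟩
        · exact ⟨∅, fun h => absurd h hes⟩
      choose g hg using h1
      refine Finset.card_le_card_of_injOn g (fun e he => ?_) (fun e he e' he' h => ?_)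
      · refine Finset.mem_coe.2 (Finset.mem_biUnion.2 ⟨e, he, Finset.mem_filter.2
          ⟨h𝓢 (hg e he).1, fun v hv => hp _ (hg e he).1 _ ?_⟩⟩)
        rw [(hg e he).2]
        exact Sym2.mem_map.2 ⟨v, hv, rfl⟩
      · have := (hg e he).2.symm.trans ((congrArg p h).trans (hg e' he').2)
        exact Subtype.ext (Sym2.map.injective φ.injective this))
  refine h𝓗 (Finset.univ.image f) ?_ ⟨φ.toEmbedding, ?_, ?_⟩
  · intro A hA
    obtain ⟨e, -, rfl⟩ := Finset.mem_image.1 hA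
    exact (Finset.mem_filter.1 (hft e)).1
  · exact Equiv.ofBijective (fun e => ⟨f e, Finset.mem_image_of_mem f (Finset.mem_univ e)⟩)
      ⟨fun e e' h => hf (congrArg Subtype.val h), fun ⟨A, hA⟩ => by
        obtain ⟨e, -, rfl⟩ := Finset.mem_image.1 hA
        exact ⟨e, rfl⟩⟩
  · intro e v hv
    exact (Finset.mem_filter.1 (hft e)).2 v hv

/-! ### A large subfamily meeting only in heavy pairs -/

/-- Any two distinct members of `𝓢` intersect in a clique of `G`. -/
def MeetInCliques {α : Type*} (G : SimpleGraph α) (𝓢 : Finset (Finset α)) : Prop :=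
  ∀ A ∈ 𝓢, ∀ B ∈ 𝓢, A ≠ B → ∀ u ∈ A, ∀ v ∈ A, u ∈ B → v ∈ B → u ≠ v → G.Adj u v

theorem MeetInCliques.mono {α : Type*} {G : SimpleGraph α} {𝓢 𝓣 : Finset (Finset α)}
    (h : MeetInCliques G 𝓢) (h𝓣 : 𝓣 ⊆ 𝓢) : MeetInCliques G 𝓣 :=
  fun A hA B hB => h A (h𝓣 hA) B (h𝓣 hB)

/-- A uniform hypergraph contains a positive proportion of its hyperedges no two of which share a
pair of vertices of small codegree. -/
theorem exists_subset_meetInCliques {α : Type*} [DecidableEq α] (𝓗 : Finset (Finset α))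
    {r : ℕ} (hr : (𝓗 : Set (Finset α)).Sized r) (k : ℕ) :
    ∃ 𝓢 ⊆ 𝓗, MeetInCliques (heavyGraph 𝓗 k) 𝓢 ∧
      𝓗.card ≤ (k * (r * r) + 1) * 𝓢.card := by
  classical
  obtain ⟨𝓢, h𝓢, hmax⟩ := Finset.exists_max_image (𝓗.powerset.filter (MeetInCliques (heavyGraph 𝓗 k))) Finset.card
    ⟨∅, Finset.mem_filter.2 ⟨Finset.empty_mem_powerset _, by simp [MeetInCliques]⟩⟩
  obtain ⟨hsub, hP⟩ := Finset.mem_filter.1 h𝓢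
  rw [Finset.mem_powerset] at hsub
  refine ⟨𝓢, hsub, hP, ?_⟩
  -- The hyperedges that share a light pair with `B`: at most `r * r` ordered pairs, each in fewer
  -- than `k` hyperedges. By maximality of `𝓢`, every hyperedge outside `𝓢` is of this kind for some
  -- `B ∈ 𝓢`.
  let N : Finset α → Finset (Finset α) := fun B =>
    ((B ×ˢ B).filter fun x => x.1 ≠ x.2 ∧ ¬ (heavyGraph 𝓗 k).Adj x.1 x.2).biUnion
      fun x => 𝓗.filter fun A => x.1 ∈ A ∧ x.2 ∈ A
  have hN : ∀ B ∈ 𝓢, (N B).card ≤ k * (r * r) := by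
    intro B hB
    rw [mul_comm]
    refine (Finset.card_biUnion_le_card_mul _ _ k ?_).trans ?_
    · intro x hx
      obtain ⟨-, hne, hx⟩ := Finset.mem_filter.1 hx
      by_contra! h
      exact hx ⟨hne, h.le⟩
    · gcongr
      refine (Finset.card_filter_le _ _).trans ?_
      rw [Finset.card_product, hr (hsub hB)]
  have hcov : 𝓗 ⊆ 𝓢 ∪ 𝓢.biUnion N := by
    intro A hA
    by_contra hAn
    simp only [Finset.mem_union, not_or] at hAn
    obtain ⟨hAS, hAN⟩ := hAn
    have hAB : ∀ B ∈ 𝓢, ∀ u ∈ A, ∀ v ∈ A, u ∈ B → v ∈ B → u ≠ v →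
        (heavyGraph 𝓗 k).Adj u v := by
      intro B hB u hu v hv hu' hv' huv
      by_contra hl
      exact hAN (Finset.mem_biUnion.2 ⟨B, hB, Finset.mem_biUnion.2 ⟨(u, v), by simp [*],
        by simp [*]⟩⟩)
    have : insert A 𝓢 ∈ 𝓗.powerset.filter (MeetInCliques (heavyGraph 𝓗 k)) := by
      refine Finset.mem_filter.2 ⟨Finset.mem_powerset.2 (Finset.insert_subset hA hsub), ?_⟩
      intro B hB C hC hBC u hu v hv hu' hv' huv
      rcases Finset.mem_insert.1 hB with rfl | hB'
      · rcases Finset.mem_insert.1 hC with rfl | hC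
        · exact absurd rfl hBC
        · exact hAB C hC u hu v hv hu' hv' huv
      · rcases Finset.mem_insert.1 hC with rfl | hC
        · exact hAB B hB' u hu' v hv' hu hv huv
        · exact hP B hB' C hC hBC u hu v hv hu' hv' huv
    have := hmax _ this
    rw [Finset.card_insert_of_notMem hAS] at this
    omega
  calc 𝓗.card ≤ 𝓢.card + (𝓢.biUnion N).card :=
        (Finset.card_le_card hcov).trans (Finset.card_union_le _ _)
    _ ≤ 𝓢.card + 𝓢.card * (k * (r * r)) := by
        gcongr
        exact Finset.card_biUnion_le_card_mul _ _ _ hN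
    _ = _ := by ring

/-! ### Cliques, light sets and triangles in `F`-free graphs -/

/-- Fewer than `|V(F)|` vertices form a clique in an `F`-free graph. -/
theorem SimpleGraph.IsClique.card_lt_of_free {V α : Type*} [Fintype V] {F : SimpleGraph V}
    {G : SimpleGraph α} (hG : F.Free G) {s : Finset α} (hs : G.IsClique s) :
    s.card < Fintype.card V := by
  by_contra! h
  obtain ⟨e⟩ := Function.Embedding.nonempty_of_card_le
    (show Fintype.card V ≤ Fintype.card s by simpa using h)
  exact hG ⟨⟨⟨fun v => (e v : α), fun {u v} huv => hs (e u).2 (e v).2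
    fun h => huv.ne (e.injective (Subtype.ext h))⟩,
    fun u v h => e.injective (Subtype.ext h)⟩⟩

/-- If adjacency is transitive on a vertex set `A` of an `F`-free graph, then deleting the closed
neighbourhood of one vertex costs fewer than `|V(F)|` vertices of `A`. -/
theorem SimpleGraph.card_filter_eq_or_adj_lt {V α : Type*} [Fintype V] [DecidableEq α]
    {F : SimpleGraph V} {G : SimpleGraph α} [DecidableRel G.Adj] (hG : F.Free G) {A : Finset α}
    (hA : ∀ u ∈ A, ∀ v ∈ A, ∀ w ∈ A, G.Adj u v → G.Adj v w → u ≠ w → G.Adj u w)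
    {x : α} (hx : x ∈ A) : (A.filter fun y => y = x ∨ G.Adj x y).card < Fintype.card V := by
  refine SimpleGraph.IsClique.card_lt_of_free hG ?_
  intro u hu v hv huv
  simp only [Finset.coe_filter, Set.mem_ofPred_eq] at hu hv
  obtain ⟨hu, rfl | hxu⟩ := hu
  · exact hv.2.resolve_left huv.symm
  · obtain ⟨hv, rfl | hxv⟩ := hv
    · exact hxu.symm
    · exact hA u hu x hx v hv hxu.symm hxv huv

theorem SimpleGraph.exists_not_adj_pair {V α : Type*} [Fintype V]
    {F : SimpleGraph V} {G : SimpleGraph α} (hG : F.Free G) {A : Finset α}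
    (hcard : Fintype.card V ≤ A.card) : ∃ x ∈ A, ∃ y ∈ A, x ≠ y ∧ ¬ G.Adj x y := by
  by_contra! h
  exact (SimpleGraph.IsClique.card_lt_of_free hG
    (fun u hu v hv huv => h u hu v hv huv)).not_ge hcard

/-- Greedy choice: each chosen vertex excludes at most `|V(F)| - 1` vertices, itself included, so a
third vertex survives two exclusions. -/
theorem SimpleGraph.exists_not_adj_triple {V α : Type*} [Fintype V]
    {F : SimpleGraph V} {G : SimpleGraph α} (hG : F.Free G) {A : Finset α}
    (hA : ∀ u ∈ A, ∀ v ∈ A, ∀ w ∈ A, G.Adj u v → G.Adj v w → u ≠ w → G.Adj u w)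
    (hcard : 2 * (Fintype.card V - 1) < A.card) :
    ∃ T ⊆ A, T.card = 3 ∧ ∀ x ∈ T, ∀ y ∈ T, ¬ G.Adj x y := by
  classical
  obtain ⟨x, hx⟩ : A.Nonempty := Finset.card_pos.1 (by omega)
  have h1 := SimpleGraph.card_filter_eq_or_adj_lt hG hA hx
  obtain ⟨y, hy, hyx⟩ := Finset.exists_mem_notMem_of_card_lt_card
    (show (A.filter fun y => y = x ∨ G.Adj x y).card < A.card by omega)
  have h2 := SimpleGraph.card_filter_eq_or_adj_lt hG hA hy
  obtain ⟨z, hz, hzxy⟩ := Finset.exists_mem_notMem_of_card_lt_card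
    (show ((A.filter fun z => z = x ∨ G.Adj x z) ∪ (A.filter fun z => z = y ∨ G.Adj y z)).card
      < A.card from (Finset.card_union_le _ _).trans_lt (by omega))
  simp only [Finset.mem_union, Finset.mem_filter, not_or, not_and, hy, hz, true_implies]
    at hyx hzxy
  refine ⟨{x, y, z}, by simp [Finset.insert_subset_iff, *], ?_, ?_⟩
  · exact Finset.card_eq_three.2 ⟨x, y, z, Ne.symm hyx.1, Ne.symm hzxy.1.1, Ne.symm hzxy.2.1, rfl⟩
  · simp only [Finset.mem_insert, Finset.mem_singleton]
    rintro a (rfl | rfl | rfl) b (rfl | rfl | rfl) <;> grind [G.irrefl, G.adj_comm]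

/-- An `F`-free graph on `n` vertices has at most `ex(n, K₃, F)` triangles. -/
theorem SimpleGraph.card_cliqueFinset_le_generalizedTuran {V : Type*} {n : ℕ}
    {F : SimpleGraph V} {G : SimpleGraph (Fin n)} [DecidableRel G.Adj] (hG : F.Free G) :
    (G.cliqueFinset 3).card ≤ generalizedTuran n (⊤ : SimpleGraph (Fin 3)) F := by
  classical
  have h1 : G.copyCount (⊤ : SimpleGraph (Fin 3)) ≤
      generalizedTuran n (⊤ : SimpleGraph (Fin 3)) F := by
    unfold generalizedTuran
    exact Finset.le_sup (f := fun G : SimpleGraph (Fin n) => G.copyCount (⊤ : SimpleGraph (Fin 3)))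
      (by simpa using hG)
  refine le_trans ?_ h1
  unfold SimpleGraph.copyCount
  refine Finset.card_le_card_of_injOn (fun s => (⊤ : G.Subgraph).induce s) ?_ ?_
  · intro s hs
    rw [Finset.mem_coe, SimpleGraph.mem_cliqueFinset_iff] at hs
    simp only [Finset.coe_filter, Finset.mem_univ, true_and, Set.mem_ofPred_eq]
    have e : Fin 3 ≃ s := (finCongr hs.card_eq.symm).trans s.equivFin.symm
    refine ⟨⟨e, ?_⟩⟩
    intro a b
    simp only [SimpleGraph.Subgraph.coe_adj, SimpleGraph.Subgraph.induce_adj,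
      SimpleGraph.Subgraph.top_adj, SimpleGraph.top_adj]
    constructor
    · rintro ⟨-, -, h⟩ rfl
      exact G.irrefl h
    · intro hab
      exact ⟨(e a).2, (e b).2, hs.isClique (e a).2 (e b).2
        fun h => hab (e.injective (Subtype.ext h))⟩
  · intro s _ t _ h
    exact Finset.coe_injective (congrArg SimpleGraph.Subgraph.verts h)

/-! ### Dense graphs contain bipartite graphs -/

/-- **Kővári–Sós–Turán**, qualitative form: a bipartite graph is contained in every large dense
graph. -/
theorem SimpleGraph.eventually_isContained_of_colorable_two {V : Type*} [Fintype V]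
    {F : SimpleGraph V} (hF : F.Colorable 2) {ε : ℝ} (hε : 0 < ε) :
    ∀ᶠ n : ℕ in atTop, ∀ (G : SimpleGraph (Fin n)) [DecidableRel G.Adj],
      ε * (n : ℝ) ^ 2 ≤ G.edgeFinset.card → F.IsContained G := by
  classical
  set t := Fintype.card V with ht
  rcases eq_or_ne t 0 with ht0 | ht0
  · have := Fintype.card_eq_zero_iff.1 (ht.symm.trans ht0)
    exact .of_forall fun n G _ _ => .of_isEmpty
  filter_upwards [eventually_gt_atTop 0,
    (tendsto_natCast_atTop_atTop (R := ℝ)).eventually_ge_atTop (t / ε),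
    (tendsto_natCast_atTop_atTop (R := ℝ)).eventually_gt_atTop ((t.factorial * t : ℕ) / ε ^ t)]
    with n hn hn1 hn2
  intro G _ hG
  rw [div_le_iff₀ hε] at hn1
  rw [div_lt_iff₀ (by positivity)] at hn2
  have hn0 : (0 : ℝ) < n := by exact_mod_cast hn
  -- A `t`-set with `t` common neighbours yields `K_{t,t}`. Without one, double counting the stars
  -- with `t` leaves bounds `∑ (deg v).choose t` by `n ^ t * t`, against convexity.
  obtain ⟨S, hS, hSt⟩ : ∃ S : Finset (Fin n), S.card = t ∧
      t ≤ (Finset.univ.filter fun v => S ⊆ G.neighborFinset v).card := by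
    by_contra! hno
    have hsum : ∑ v, (G.degree v).choose t ≤ n ^ t * t := by
      calc ∑ v, (G.degree v).choose t
          = ∑ v : Fin n, ((Finset.powersetCard t Finset.univ).filter
              fun S => S ⊆ G.neighborFinset v).card := by
            refine Finset.sum_congr rfl fun v _ => ?_
            rw [← SimpleGraph.card_neighborFinset_eq_degree, ← Finset.card_powersetCard]
            congr 1
            ext S
            simp [Finset.mem_powersetCard, and_comm]
        _ = ∑ S ∈ Finset.powersetCard t (Finset.univ : Finset (Fin n)),
              (Finset.univ.filter fun v => S ⊆ G.neighborFinset v).card :=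
            Finset.sum_card_bipartiteAbove_eq_sum_card_bipartiteBelow _
        _ ≤ ∑ S ∈ Finset.powersetCard t (Finset.univ : Finset (Fin n)), t :=
            Finset.sum_le_sum fun S hS => (hno S (Finset.mem_powersetCard.1 hS).2).le
        _ ≤ n ^ t * t := by
            rw [Finset.sum_const, smul_eq_mul, Finset.card_powersetCard, Finset.card_univ,
              Fintype.card_fin]
            gcongr
            exact Nat.choose_le_pow n t
    have hpow : ∑ v, (G.degree v + 1 - t) ^ t ≤ t.factorial * (n ^ t * t) := by
      refine le_trans (Finset.sum_le_sum fun v _ => ?_) (Nat.mul_le_mul_left t.factorial hsum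
        |>.trans' (Finset.mul_sum _ _ _).ge)
      rw [← Nat.descFactorial_eq_factorial_mul_choose]
      exact Nat.pow_sub_le_descFactorial _ _
    -- The degree sum is at least `2εn²`, and the loss `tn` is at most `εn²` since `n ≥ t / ε`.
    have hlow : ε * (n : ℝ) ^ 2 ≤ ∑ v, ((G.degree v + 1 - t : ℕ) : ℝ) := by
      have h1 : ∑ v, ((G.degree v : ℝ) - t) ≤ ∑ v, ((G.degree v + 1 - t : ℕ) : ℝ) := by
        refine Finset.sum_le_sum fun v _ => ?_
        rw [sub_le_iff_le_add]
        exact_mod_cast (by omega : G.degree v ≤ G.degree v + 1 - t + t)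
      refine le_trans ?_ h1
      rw [Finset.sum_sub_distrib, ← Nat.cast_sum, G.sum_degrees_eq_twice_card_edges]
      simp only [Finset.sum_const, Finset.card_univ, Fintype.card_fin, nsmul_eq_mul]
      push_cast
      nlinarith
    obtain ⟨m, hm⟩ := Nat.exists_eq_succ_of_ne_zero ht0
    have hjensen := pow_sum_div_card_le_sum_pow (s := (Finset.univ : Finset (Fin n)))
      (f := fun v => ((G.degree v + 1 - t : ℕ) : ℝ)) (fun _ _ => Nat.cast_nonneg _) m
    rw [← Nat.succ_eq_add_one, ← hm, Finset.card_univ, Fintype.card_fin,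
      div_le_iff₀ (by positivity)] at hjensen
    have hpow' : ∑ v, ((G.degree v + 1 - t : ℕ) : ℝ) ^ t ≤ (t.factorial * t : ℕ) * (n : ℝ) ^ t := by
      calc _ ≤ ((t.factorial * (n ^ t * t) : ℕ) : ℝ) := by exact_mod_cast hpow
        _ = _ := by push_cast; ring
    have h1 : (ε * (n : ℝ) ^ 2) ^ t ≤ (t.factorial * t : ℕ) * (n : ℝ) ^ t * (n : ℝ) ^ m :=
      (pow_le_pow_left₀ (by positivity) hlow t).trans (hjensen.trans (by gcongr))
    have h2 : (ε * (n : ℝ) ^ 2) ^ t = (n * ε ^ t) * (n : ℝ) ^ t * (n : ℝ) ^ m := by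
      have : (n : ℝ) ^ t = n * (n : ℝ) ^ m := by rw [hm, pow_succ']
      rw [mul_pow, ← pow_mul, mul_comm 2 t, pow_mul, sq]
      nth_rewrite 2 [this]
      ring
    rw [h2] at h1
    have h3 : (0 : ℝ) < (n : ℝ) ^ t * (n : ℝ) ^ m := by positivity
    nlinarith
  obtain ⟨c⟩ := hF
  obtain ⟨e₀⟩ := Function.Embedding.nonempty_of_card_le
    (show Fintype.card V ≤ Fintype.card S by simp [hS, ht])
  obtain ⟨e₁⟩ := Function.Embedding.nonempty_of_card_le
    (show Fintype.card V ≤ Fintype.card (Finset.univ.filter fun v => S ⊆ G.neighborFinset v) by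
      rw [Fintype.card_coe]; exact hSt)
  have hadj : ∀ u v, G.Adj (e₀ u) (e₁ v) := fun u v => by
    have := (Finset.mem_filter.1 (e₁ v).2).2 (e₀ u).2
    exact ((SimpleGraph.mem_neighborFinset _ _ _).1 this).symm
  have hcol : ∀ v, c v = 0 ∨ c v = 1 := fun v => by omega
  refine ⟨⟨⟨fun v => if c v = 0 then (e₀ v : Fin n) else e₁ v, fun {u v} huv => ?_⟩,
    fun u v huv => ?_⟩⟩
  · have := c.valid huv
    rcases hcol u with hu | hu <;> rcases hcol v with hv | hv <;> simp [hu, hv] at this ⊢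
    · exact hadj u v
    · exact (hadj v u).symm
  · rcases hcol u with hu | hu <;> rcases hcol v with hv | hv <;> simp [hu, hv] at huv
    · exact huv
    · exact absurd huv (hadj u v).ne
    · exact absurd huv.symm (hadj v u).ne
    · exact huv

/-! ### Hyperedges with a heavy path closed by a light pair -/

/-- If every hyperedge of `𝓢` contains two heavy pairs `uv`, `vw` with `uw` light, then `𝓢` has at
most `ex(n, K₃, F)` hyperedges. -/
theorem BergeFree.card_le_generalizedTuran_of_heavy_path {V : Type*} [Fintype V] {n : ℕ}
    {F : SimpleGraph V} {𝓗 : Finset (Finset (Fin n))} (h𝓗 : BergeFree F 𝓗)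
    {𝓢 : Finset (Finset (Fin n))} (h𝓢 : 𝓢 ⊆ 𝓗)
    (hmeet : MeetInCliques (heavyGraph 𝓗 (Nat.card F.edgeSet)) 𝓢)
    (hpath : ∀ A ∈ 𝓢, ∃ u ∈ A, ∃ v ∈ A, ∃ w ∈ A,
      (heavyGraph 𝓗 (Nat.card F.edgeSet)).Adj u v ∧ (heavyGraph 𝓗 (Nat.card F.edgeSet)).Adj v w ∧
        u ≠ w ∧ ¬ (heavyGraph 𝓗 (Nat.card F.edgeSet)).Adj u w) :
    𝓢.card ≤ generalizedTuran n (⊤ : SimpleGraph (Fin 3)) F := by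
  classical
  rcases 𝓢.eq_empty_or_nonempty with rfl | ⟨A₀, hA₀⟩
  · simp
  have : Nonempty (Fin n) := ⟨(hpath A₀ hA₀).choose⟩
  choose! u hu v hv w hw huv hvw huw hnot using hpath
  have hfree := h𝓗.free_heavyGraph_sup h𝓢 (fun A => s(u A, w A)) (by
    intro A hA x hx
    rcases Sym2.mem_iff.1 hx with rfl | rfl
    · exact hu A hA
    · exact hw A hA)
  refine le_trans ?_ (SimpleGraph.card_cliqueFinset_le_generalizedTuran hfree)
  refine Finset.card_le_card_of_injOn (fun A => {u A, v A, w A}) ?_ ?_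
  · intro A hA
    rw [Finset.mem_coe, SimpleGraph.mem_cliqueFinset_iff, SimpleGraph.is3Clique_iff]
    refine ⟨u A, v A, w A, Or.inl (huv A hA), Or.inr ?_, Or.inl (hvw A hA), rfl⟩
    rw [SimpleGraph.fromEdgeSet_adj]
    exact ⟨⟨A, hA, rfl⟩, huw A hA⟩
  -- Two hyperedges with the same triangle would share the light pair `u A`, `w A`.
  · intro A hA B hB hAB
    by_contra hne
    have hsub : ({u B, v B, w B} : Finset (Fin n)) ⊆ B := by
      simp [Finset.insert_subset_iff, hu B hB, hv B hB, hw B hB]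
    simp only at hAB
    rw [← hAB] at hsub
    exact hnot A hA (hmeet A hA B hB hne _ (hu A hA) _ (hw A hA) (hsub (by simp))
      (hsub (by simp)) (huw A hA))

/-! ### Light triples: triangle removal and averaging -/

/-- The three pairs contained in a 3-element set. -/
theorem Finset.exists_pairs_of_card_eq_three {α : Type*} {T : Finset α} (hT : T.card = 3) :
    ∃ p : Fin 3 → Sym2 α, (∀ i, ∀ v ∈ p i, v ∈ T) ∧
      ∀ u ∈ T, ∀ v ∈ T, u ≠ v → ∃ i, p i = s(u, v) := by
  classical
  obtain ⟨a, b, c, -, -, -, rfl⟩ := Finset.card_eq_three.1 hT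
  refine ⟨![s(a, b), s(a, c), s(b, c)], ?_, ?_⟩
  · intro i v
    fin_cases i <;> simp <;> rintro (rfl | rfl) <;> simp
  · simp only [Fin.exists_fin_succ, Finset.mem_insert, Finset.mem_singleton]
    rintro u (rfl | rfl | rfl) v (rfl | rfl | rfl) huv <;> simp_all [Sym2.eq_swap]

theorem Fintype.card_fun_le_mul_card_filter_three {ι : Type*} [Fintype ι] [DecidableEq ι]
    {a b c : ι} (hab : a ≠ b) (hac : a ≠ c) (hbc : b ≠ c) (i j k : Fin 3) :
    Fintype.card (ι → Fin 3) ≤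
      27 * (Finset.univ.filter fun f : ι → Fin 3 => f a = i ∧ f b = j ∧ f c = k).card := by
  -- Overwrite the values at `a`, `b`, `c` by `i`, `j`, `k` and record the old ones: 27 possible
  -- records.
  have := Finset.card_le_card_of_injOn (s := (Finset.univ : Finset (ι → Fin 3)))
    (t := (Finset.univ : Finset (Fin 3 × Fin 3 × Fin 3)) ×ˢ
      (Finset.univ.filter fun f : ι → Fin 3 => f a = i ∧ f b = j ∧ f c = k))
    (fun f => ((f a, f b, f c),
      Function.update (Function.update (Function.update f a i) b j) c k)) (by
      intro f _
      simp [Function.update_of_ne, hab, hac, hbc]) (by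
      intro f _ g _ hfg
      simp only [Prod.mk.injEq] at hfg
      obtain ⟨⟨ha, hb, hc⟩, h⟩ := hfg
      ext x
      have := congrFun h x
      simp only [Function.update_apply] at this
      split_ifs at this <;> simp_all)
  simpa [Finset.card_product] using this

/-- Averaging over all functions `ι → Fin 3`: if each `t ∈ R` is good as soon as three prescribed
values are taken, then some function makes a `1/27` fraction of `R` good. -/
theorem exists_fun_card_le_mul_card_filter {ι β : Type*} [Fintype ι] [DecidableEq ι]
    (R : Finset β) (good : (ι → Fin 3) → β → Prop) [∀ f, DecidablePred (good f)]
    (h : ∀ t ∈ R, ∃ a b c : ι, a ≠ b ∧ a ≠ c ∧ b ≠ c ∧ ∃ i j k : Fin 3,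
      ∀ f : ι → Fin 3, f a = i → f b = j → f c = k → good f t) :
    ∃ f : ι → Fin 3, R.card ≤ 27 * (R.filter (good f)).card := by
  classical
  suffices hs : ∑ _f : ι → Fin 3, R.card ≤ ∑ f : ι → Fin 3, 27 * (R.filter (good f)).card by
    obtain ⟨f, -, hf⟩ := Finset.exists_le_of_sum_le Finset.univ_nonempty hs
    exact ⟨f, hf⟩
  calc ∑ _f : ι → Fin 3, R.card = ∑ _t ∈ R, Fintype.card (ι → Fin 3) := by
        simp [mul_comm]
    _ ≤ ∑ t ∈ R, 27 * (Finset.univ.filter fun f => good f t).card := by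
        refine Finset.sum_le_sum fun t ht => ?_
        obtain ⟨a, b, c, hab, hac, hbc, i, j, k, hg⟩ := h t ht
        refine (Fintype.card_fun_le_mul_card_filter_three hab hac hbc i j k).trans ?_
        gcongr with f
        rintro ⟨ha, hb, hc⟩
        exact hg f ha hb hc
    _ = ∑ f : ι → Fin 3, 27 * (R.filter (good f)).card := by
        rw [← Finset.mul_sum, ← Finset.mul_sum]
        congr 1
        exact (Finset.sum_card_bipartiteAbove_eq_sum_card_bipartiteBelow
          (fun t (f : ι → Fin 3) => good f t))

/-- If distinct hyperedges meet in cliques, then a nonadjacent pair lies in only one of them. -/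
theorem MeetInCliques.injOn_of_not_adj {α : Type*} {G : SimpleGraph α}
    {𝓢 : Finset (Finset α)} (hmeet : MeetInCliques G 𝓢) (p : Finset α → Sym2 α)
    (hp : ∀ A ∈ 𝓢, (∀ v ∈ p A, v ∈ A) ∧ ¬ (p A).IsDiag ∧ p A ∉ G.edgeSet) :
    Set.InjOn p 𝓢 := by
  intro A hA B hB hAB
  by_contra hne
  obtain ⟨h1, h2, h3⟩ := hp A hA
  obtain ⟨h4, -, -⟩ := hp B hB
  rw [← hAB] at h4
  generalize p A = e at *
  induction e with | _ u v
  exact h3 (hmeet A hA B hB hne u (h1 u (by simp)) v (h1 v (by simp)) (h4 u (by simp))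
    (h4 v (by simp)) h2)

/-- If a positive proportion of `n ^ 2` hyperedges contain a triple of pairwise light vertices,
then the triangle removal lemma yields many triangles in an `F`-free graph. -/
theorem BergeFree.removalBound_le_of_light_triple {V : Type*} [Fintype V] {n : ℕ}
    {F : SimpleGraph V} {𝓗 : Finset (Finset (Fin n))} (h𝓗 : BergeFree F 𝓗)
    {𝓢 : Finset (Finset (Fin n))} (h𝓢 : 𝓢 ⊆ 𝓗)
    (hmeet : MeetInCliques (heavyGraph 𝓗 (Nat.card F.edgeSet)) 𝓢)
    (htriple : ∀ A ∈ 𝓢, ∃ T ⊆ A, T.card = 3 ∧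
      ∀ x ∈ T, ∀ y ∈ T, ¬ (heavyGraph 𝓗 (Nat.card F.edgeSet)).Adj x y)
    {ε : ℝ} (hε : ε * (n : ℝ) ^ 2 ≤ 𝓢.card) :
    SimpleGraph.triangleRemovalBound ε * (n : ℝ) ^ 3 ≤
      27 * generalizedTuran n (⊤ : SimpleGraph (Fin 3)) F + 𝓢.card := by
  classical
  choose! T hTA hT3 hTl using htriple
  rcases Nat.eq_zero_or_pos n with rfl | hn
  · simp only [CharP.cast_eq_zero, ne_eq, OfNat.ofNat_ne_zero, not_false_eq_true, zero_pow,
      mul_zero]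
    positivity
  have : Nonempty (Sym2 (Fin n)) := ⟨s(⟨0, hn⟩, ⟨0, hn⟩)⟩
  have hpairs : ∀ A ∈ 𝓢, ∃ p : Fin 3 → Sym2 (Fin n), (∀ i, ∀ v ∈ p i, v ∈ T A) ∧
      ∀ u ∈ T A, ∀ v ∈ T A, u ≠ v → ∃ i, p i = s(u, v) := fun A hA =>
    Finset.exists_pairs_of_card_eq_three (hT3 A hA)
  choose! p hp using hpairs
  have hmeetT : ∀ A ∈ 𝓢, ∀ B ∈ 𝓢, ∀ u ∈ T A, ∀ v ∈ T A, u ∈ T B → v ∈ T B → u ≠ v → A = B := by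
    intro A hA B hB u hu v hv hu' hv' huv
    by_contra hne
    exact hTl A hA u hu v hv (hmeet A hA B hB hne u (hTA A hA hu) v (hTA A hA hv)
      (hTA B hB hu') (hTA B hB hv') huv)
  have hTinj : Set.InjOn T 𝓢 := by
    intro A hA B hB hAB
    obtain ⟨u, hu, v, hv, huv⟩ := Finset.one_lt_card.1 (by rw [hT3 A hA]; norm_num)
    exact hmeetT A hA B hB u hu v hv (hAB ▸ hu) (hAB ▸ hv) huv
  let G : SimpleGraph (Fin n) :=
    { Adj := fun u v => u ≠ v ∧ ∃ A ∈ 𝓢, u ∈ T A ∧ v ∈ T A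
      symm := ⟨fun u v h => ⟨h.1.symm, h.2.imp fun A hA => ⟨hA.1, hA.2.2, hA.2.1⟩⟩⟩
      loopless := ⟨fun _ h => h.1 rfl⟩ }
  have hfar : G.FarFromTriangleFree ε := by
    refine SimpleGraph.farFromTriangleFree_of_disjoint_triangles (𝓢.image T) ?_ ?_ ?_
    · intro t ht
      obtain ⟨A, hA, rfl⟩ := Finset.mem_image.1 ht
      rw [SimpleGraph.mem_cliqueFinset_iff]
      exact ⟨fun u hu v hv huv => ⟨huv, A, hA, hu, hv⟩, hT3 A hA⟩
    · intro s hs t ht hst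
      obtain ⟨A, hA, rfl⟩ := Finset.mem_image.1 (Finset.mem_coe.1 hs)
      obtain ⟨B, hB, rfl⟩ := Finset.mem_image.1 (Finset.mem_coe.1 ht)
      intro u hu v hv
      by_contra huv
      exact hst (congrArg T (hmeetT A hA B hB u hu.1 v hv.1 hu.2 hv.2 huv))
    · rw [Finset.card_image_of_injOn hTinj]
      simpa using hε
  have hmany := hfar.le_card_cliqueFinset
  rw [Fintype.card_fin] at hmany
  -- The three edges of a triangle in `R` come from three different hyperedges, since two edges from
  -- one triple would make the triangle that triple. So the three choices are independent.
  let R := G.cliqueFinset 3 \ 𝓢.image T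
  let G' : (Finset (Fin n) → Fin 3) → SimpleGraph (Fin n) := fun f =>
    heavyGraph 𝓗 (Nat.card F.edgeSet) ⊔ SimpleGraph.fromEdgeSet ((fun A => p A (f A)) '' 𝓢)
  obtain ⟨f, hf⟩ := exists_fun_card_le_mul_card_filter R (fun f t => t ∈ (G' f).cliqueFinset 3) (by
    intro t ht
    obtain ⟨ht, htT⟩ := Finset.mem_sdiff.1 ht
    rw [SimpleGraph.mem_cliqueFinset_iff] at ht
    have ht3 := ht.card_eq
    obtain ⟨x, y, z, hxy, hxz, hyz, rfl⟩ := SimpleGraph.is3Clique_iff.1 ht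
    have hne : ∀ A ∈ 𝓢, x ∈ T A → y ∈ T A → z ∈ T A → False := by
      intro A hA hx hy hz
      refine htT (Finset.mem_image.2 ⟨A, hA, (Finset.eq_of_subset_of_card_le ?_ ?_).symm⟩)
      · simp [Finset.insert_subset_iff, hx, hy, hz]
      · rw [hT3 A hA, ht3]
    obtain ⟨hxy', A, hA, hxA, hyA⟩ := hxy
    obtain ⟨hxz', B, hB, hxB, hzB⟩ := hxz
    obtain ⟨hyz', C, hC, hyC, hzC⟩ := hyz
    obtain ⟨i, hi⟩ := (hp A hA).2 x hxA y hyA hxy'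
    obtain ⟨j, hj⟩ := (hp B hB).2 x hxB z hzB hxz'
    obtain ⟨k, hk⟩ := (hp C hC).2 y hyC z hzC hyz'
    refine ⟨A, B, C, ?_, ?_, ?_, i, j, k, ?_⟩
    · rintro rfl; exact hne A hA hxA hyA hzB
    · rintro rfl; exact hne A hA hxA hyA hzC
    · rintro rfl; exact hne B hB hxB hyC hzB
    · rintro f rfl rfl rfl
      rw [SimpleGraph.mem_cliqueFinset_iff, SimpleGraph.is3Clique_iff]
      exact ⟨x, y, z, Or.inr ((SimpleGraph.fromEdgeSet_adj _).2 ⟨⟨A, hA, hi⟩, hxy'⟩),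
        Or.inr ((SimpleGraph.fromEdgeSet_adj _).2 ⟨⟨B, hB, hj⟩, hxz'⟩),
        Or.inr ((SimpleGraph.fromEdgeSet_adj _).2 ⟨⟨C, hC, hk⟩, hyz'⟩), rfl⟩)
  have hfree : F.Free (G' f) := h𝓗.free_heavyGraph_sup h𝓢 (fun A => p A (f A))
    fun A hA v hv => hTA A hA ((hp A hA).1 _ v hv)
  have hfew := SimpleGraph.card_cliqueFinset_le_generalizedTuran hfree
  have h1 : (G.cliqueFinset 3).card ≤ R.card + 𝓢.card :=
    calc _ ≤ R.card + (𝓢.image T).card := by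
          rw [← Nat.sub_le_iff_le_add]
          exact Finset.le_card_sdiff (𝓢.image T) (G.cliqueFinset 3)
      _ ≤ _ := Nat.add_le_add_left Finset.card_image_le _
  have h2 : (R.filter fun t => t ∈ (G' f).cliqueFinset 3).card ≤ ((G' f).cliqueFinset 3).card :=
    Finset.card_le_card fun t ht => (Finset.mem_filter.1 ht).2
  refine hmany.trans ?_
  exact_mod_cast (by omega : (G.cliqueFinset 3).card ≤
    27 * generalizedTuran n (⊤ : SimpleGraph (Fin 3)) F + 𝓢.card)

/-- Bounds `𝓢` by a number of pairs, hence quadratically in the number of vertices. -/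
theorem MeetInCliques.exists_injOn_light_pair {α : Type*} [Nonempty α] {G : SimpleGraph α}
    {𝓢 : Finset (Finset α)} (hmeet : MeetInCliques G 𝓢)
    (hpair : ∀ A ∈ 𝓢, ∃ x ∈ A, ∃ y ∈ A, x ≠ y ∧ ¬ G.Adj x y) :
    ∃ p : Finset α → Sym2 α, Set.InjOn p 𝓢 ∧
      ∀ A ∈ 𝓢, (∀ v ∈ p A, v ∈ A) ∧ ¬ (p A).IsDiag := by
  choose! x hx y hy hxy hnot using hpair
  have hp : ∀ A ∈ 𝓢, (∀ v ∈ s(x A, y A), v ∈ A) ∧ ¬ s(x A, y A).IsDiag ∧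
      s(x A, y A) ∉ G.edgeSet := by
    intro A hA
    refine ⟨?_, hxy A hA, hnot A hA⟩
    intro v hv
    rcases Sym2.mem_iff.1 hv with rfl | rfl
    · exact hx A hA
    · exact hy A hA
  exact ⟨_, hmeet.injOn_of_not_adj _ hp, fun A hA => ⟨(hp A hA).1, (hp A hA).2.1⟩⟩

theorem BergeFree.free_heavyGraph {V α : Type*} [Fintype V] [DecidableEq α]
    {F : SimpleGraph V} {𝓗 : Finset (Finset α)} (h𝓗 : BergeFree F 𝓗) :
    F.Free (heavyGraph 𝓗 (Nat.card F.edgeSet)) := by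
  intro hc
  -- The constant choice of pair below needs a vertex of `α`, which a vertex of `F` supplies; for
  -- empty `V` the empty family is already a Berge copy.
  rcases isEmpty_or_nonempty V with hV | ⟨⟨v⟩⟩
  · exact h𝓗 ∅ (Finset.empty_subset _) ⟨Function.Embedding.ofIsEmpty,
      Equiv.equivOfIsEmpty _ _, fun e => isEmptyElim e⟩
  · obtain ⟨φ⟩ := id hc
    exact h𝓗.free_heavyGraph_sup (Finset.empty_subset _) (fun _ => s(φ v, φ v)) (by simp)
      (hc.mono_right le_sup_left)

/-! ### Asymptotic bounds and the threshold -/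

/-- For bipartite `F`, only `o(n ^ 2)` hyperedges of a Berge-`F`-free hypergraph can own a light
pair each. -/
theorem eventually_card_le_of_colorable_two {V : Type*} [Fintype V] {F : SimpleGraph V}
    (hF : F.Colorable 2) {ε : ℝ} (hε : 0 < ε) :
    ∀ᶠ n : ℕ in atTop, ∀ 𝓗 : Finset (Finset (Fin n)), BergeFree F 𝓗 → ∀ 𝓢 ⊆ 𝓗,
      MeetInCliques (heavyGraph 𝓗 (Nat.card F.edgeSet)) 𝓢 →
      (∀ A ∈ 𝓢, Fintype.card V ≤ A.card) → (𝓢.card : ℝ) ≤ ε * (n : ℝ) ^ 2 := by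
  classical
  filter_upwards [eventually_gt_atTop 0,
    SimpleGraph.eventually_isContained_of_colorable_two hF hε] with n hn hdense 𝓗 h𝓗 𝓢 h𝓢 hmeet hr
  have : Nonempty (Fin n) := ⟨⟨0, hn⟩⟩
  by_contra! hcard
  obtain ⟨p, hinj, hp⟩ := hmeet.exists_injOn_light_pair
    fun A hA => SimpleGraph.exists_not_adj_pair h𝓗.free_heavyGraph (hr A hA)
  have hfree := h𝓗.free_heavyGraph_sup h𝓢 p fun A hA => (hp A hA).1
  obtain ⟨G, hG⟩ : ∃ G, G = SimpleGraph.fromEdgeSet (p '' 𝓢) := ⟨_, rfl⟩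
  rw [← hG] at hfree
  refine hfree ((hdense G ?_).mono_right le_sup_right)
  refine hcard.le.trans ?_
  rw [← Finset.card_image_of_injOn hinj]
  refine Nat.cast_le.2 (Finset.card_le_card fun e he => ?_)
  obtain ⟨A, hA, rfl⟩ := Finset.mem_image.1 he
  rw [SimpleGraph.mem_edgeFinset, hG, SimpleGraph.edgeSet_fromEdgeSet]
  exact ⟨⟨A, hA, rfl⟩, (hp A hA).2⟩

/-- If `ex(n, K₃, F) = o(n ^ 2)`, then only `o(n ^ 2)` hyperedges of a Berge-`F`-free hypergraph
can own a light triple each. -/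
theorem eventually_card_le_of_generalizedTuran {V : Type*} [Fintype V] {F : SimpleGraph V}
    (h : (fun n : ℕ => (generalizedTuran n (⊤ : SimpleGraph (Fin 3)) F : ℝ))
      =o[atTop] fun n : ℕ => (n : ℝ) ^ 2) {ε : ℝ} (hε : 0 < ε) :
    ∀ᶠ n : ℕ in atTop, ∀ 𝓗 : Finset (Finset (Fin n)), BergeFree F 𝓗 → ∀ 𝓢 ⊆ 𝓗,
      MeetInCliques (heavyGraph 𝓗 (Nat.card F.edgeSet)) 𝓢 →
      (∀ A ∈ 𝓢, ∃ T ⊆ A, T.card = 3 ∧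
        ∀ x ∈ T, ∀ y ∈ T, ¬ (heavyGraph 𝓗 (Nat.card F.edgeSet)).Adj x y) →
      (𝓢.card : ℝ) ≤ ε * (n : ℝ) ^ 2 := by
  have hδ := SimpleGraph.triangleRemovalBound_pos hε
  filter_upwards [eventually_gt_atTop 0, isLittleO_iff.1 h one_pos,
    -- 28 = 27 + 1: both `ex(n, K₃, F)` and `𝓢.card` are at most `n ^ 2` here.
    (tendsto_natCast_atTop_atTop (R := ℝ)).eventually_gt_atTop
      (28 / SimpleGraph.triangleRemovalBound ε)] with n hn hT hlarge 𝓗 h𝓗 𝓢 h𝓢 hmeet htriple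
  have : Nonempty (Fin n) := ⟨⟨0, hn⟩⟩
  by_contra! hcard
  have hmany := h𝓗.removalBound_le_of_light_triple h𝓢 hmeet htriple hcard.le
  obtain ⟨p, hinj, -⟩ := hmeet.exists_injOn_light_pair fun A hA => by
    obtain ⟨T, hTA, hT3, hT⟩ := htriple A hA
    obtain ⟨x, hx, y, hy, hxy⟩ := Finset.one_lt_card.1 (by rw [hT3]; norm_num : 1 < T.card)
    exact ⟨x, hTA hx, y, hTA hy, hxy, hT x hx y hy⟩
  have hle : (𝓢.card : ℝ) ≤ (n : ℝ) ^ 2 := by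
    have h1 : 𝓢.card ≤ Fintype.card (Sym2 (Fin n)) :=
      Finset.card_le_card_of_injOn p (fun _ _ => Finset.mem_coe.2 (Finset.mem_univ _)) hinj
    have h2 : Fintype.card (Sym2 (Fin n)) ≤ Fintype.card (Fin n × Fin n) :=
      Fintype.card_le_of_surjective _ Sym2.mk_surjective
    rw [Fintype.card_prod, Fintype.card_fin] at h2
    rw [sq]
    exact_mod_cast h1.trans h2
  rw [Real.norm_natCast, one_mul, Real.norm_of_nonneg (by positivity)] at hT
  rw [div_lt_iff₀ hδ] at hlarge
  have hn2 : (0 : ℝ) < (n : ℝ) ^ 2 := by positivity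
  nlinarith

/-- Hyperedges of a Berge-`F`-free hypergraph with more than `(m - 1)(|V(F)| - 1)` vertices, where
`m = 2` if `F` is bipartite and `m = 3` otherwise, number `o(n ^ 2)` if `ex(n, K₃, F)` is
`o(n ^ 2)`. -/
theorem exBerge_isLittleO {V : Type*} [Fintype V] {F : SimpleGraph V} {r : ℕ}
    (hr : F.Colorable 2 ∧ Fintype.card V ≤ r ∨ 2 * (Fintype.card V - 1) < r)
    (h : (fun n : ℕ => (generalizedTuran n (⊤ : SimpleGraph (Fin 3)) F : ℝ))
      =o[atTop] fun n : ℕ => (n : ℝ) ^ 2) :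
    (fun n : ℕ => (exBerge r n F : ℝ)) =o[atTop] fun n : ℕ => (n : ℝ) ^ 2 := by
  classical
  rw [isLittleO_iff]
  intro c hc
  set k := Nat.card F.edgeSet with hk
  set M : ℕ := k * (r * r) + 1 with hM
  have hM0 : (0 : ℝ) < M := by positivity
  -- `M` pays for passing to `𝓢`, and 2 for splitting `𝓢` by whether heaviness is transitive on the
  -- hyperedge.
  have hε : 0 < c / (2 * M) := by positivity
  have hlight : ∀ᶠ n : ℕ in atTop, ∀ 𝓗 : Finset (Finset (Fin n)), BergeFree F 𝓗 → ∀ 𝓢 ⊆ 𝓗,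
      MeetInCliques (heavyGraph 𝓗 k) 𝓢 → (∀ A ∈ 𝓢, A.card = r) →
      (∀ A ∈ 𝓢, ∀ u ∈ A, ∀ v ∈ A, ∀ w ∈ A, (heavyGraph 𝓗 k).Adj u v →
        (heavyGraph 𝓗 k).Adj v w → u ≠ w → (heavyGraph 𝓗 k).Adj u w) →
      (𝓢.card : ℝ) ≤ c / (2 * M) * (n : ℝ) ^ 2 := by
    rcases hr with ⟨hF, hr⟩ | hr
    · filter_upwards [eventually_card_le_of_colorable_two hF hε] with n hn 𝓗 h𝓗 𝓢 h𝓢 hmeet hA _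
      exact hn 𝓗 h𝓗 𝓢 h𝓢 hmeet fun A hAS => by rw [hA A hAS]; exact hr
    · filter_upwards [eventually_card_le_of_generalizedTuran h hε] with n hn 𝓗 h𝓗 𝓢 h𝓢 hmeet hA ht
      exact hn 𝓗 h𝓗 𝓢 h𝓢 hmeet fun A hAS =>
        SimpleGraph.exists_not_adj_triple h𝓗.free_heavyGraph (ht A hAS) (by rw [hA A hAS]; exact hr)
  filter_upwards [isLittleO_iff.1 h hε, hlight] with n hT hlight
  rw [Real.norm_natCast, Real.norm_of_nonneg (by positivity)] at hT ⊢
  suffices hs : ∀ 𝓗 : Finset (Finset (Fin n)), (𝓗 : Set (Finset (Fin n))).Sized r →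
      BergeFree F 𝓗 → (𝓗.card : ℝ) ≤ c * (n : ℝ) ^ 2 by
    rw [← Nat.le_floor_iff (by positivity)]
    refine Finset.sup_le fun 𝓗 h𝓗 => ?_
    simp only [Finset.mem_filter, Finset.mem_univ, true_and] at h𝓗
    exact Nat.le_floor (hs 𝓗 h𝓗.1 h𝓗.2)
  intro 𝓗 hsized h𝓗
  obtain ⟨𝓢, h𝓢, hmeet, hcard⟩ := exists_subset_meetInCliques 𝓗 hsized k
  let Q : Finset (Fin n) → Prop := fun A => ∃ u ∈ A, ∃ v ∈ A, ∃ w ∈ A,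
    (heavyGraph 𝓗 k).Adj u v ∧ (heavyGraph 𝓗 k).Adj v w ∧ u ≠ w ∧ ¬ (heavyGraph 𝓗 k).Adj u w
  have h1 : ((𝓢.filter Q).card : ℝ) ≤ c / (2 * M) * (n : ℝ) ^ 2 := by
    refine le_trans (Nat.cast_le.2 ?_) hT
    exact h𝓗.card_le_generalizedTuran_of_heavy_path ((Finset.filter_subset _ _).trans h𝓢)
      (hmeet.mono (Finset.filter_subset _ _)) fun A hA => (Finset.mem_filter.1 hA).2
  have h2 : ((𝓢.filter fun A => ¬ Q A).card : ℝ) ≤ c / (2 * M) * (n : ℝ) ^ 2 := by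
    refine hlight 𝓗 h𝓗 _ ((Finset.filter_subset _ _).trans h𝓢)
      (hmeet.mono (Finset.filter_subset _ _))
      (fun A hA => hsized (h𝓢 (Finset.mem_filter.1 hA).1)) ?_
    intro A hA u hu v hv w hw huv hvw huw
    by_contra hnot
    exact (Finset.mem_filter.1 hA).2 ⟨u, hu, v, hv, w, hw, huv, hvw, huw, hnot⟩
  have h3 : (𝓢.card : ℝ) = (𝓢.filter Q).card + (𝓢.filter fun A => ¬ Q A).card := by
    exact_mod_cast (Finset.card_filter_add_card_filter_not Q).symm
  calc (𝓗.card : ℝ) ≤ M * 𝓢.card := by exact_mod_cast hcard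
    _ ≤ M * (c / (2 * M) * (n : ℝ) ^ 2 + c / (2 * M) * (n : ℝ) ^ 2) := by
        rw [h3]; gcongr
    _ = c * (n : ℝ) ^ 2 := by field_simp; ring

theorem theorem1p4 {V : Type*} [Fintype V] (F : SimpleGraph V) (hF : F ≠ ⊥)
    (h : (fun n : ℕ => (generalizedTuran n (⊤ : SimpleGraph (Fin 3)) F : ℝ))
      =o[atTop] fun n : ℕ => (n : ℝ) ^ 2) :
    uniformityThreshold F ≤
      (F.chromaticNumber - 1) * ((Fintype.card V : ℕ∞) - 1) + 1 := by
  obtain ⟨u, v, huv⟩ := SimpleGraph.ne_bot_iff_exists_adj.1 hF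
  have hV : 2 ≤ Fintype.card V := Fintype.one_lt_card_iff.2 ⟨u, v, huv.ne⟩
  obtain ⟨m, hm⟩ := ENat.ne_top_iff_exists.1
    (SimpleGraph.chromaticNumber_ne_top_iff_exists.2 ⟨_, F.colorable_of_fintype⟩)
  have hcol : F.Colorable m := SimpleGraph.chromaticNumber_le_iff_colorable.1 hm.ge
  have hm2 : 2 ≤ m := by
    by_contra! hlt
    obtain ⟨c⟩ := hcol.mono (by omega : m ≤ 1)
    exact c.valid huv (Subsingleton.elim _ _)
  rw [← hm]
  refine sInf_le ⟨(m - 1) * (Fintype.card V - 1) + 1, by push_cast; rfl, ?_, fun r hr => ?_⟩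
  · have : 0 < (m - 1) * (Fintype.card V - 1) := Nat.mul_pos (by omega) (by omega)
    omega
  · refine exBerge_isLittleO ?_ h
    -- Three light vertices suffice for every `m ≥ 3`, so only `m - 1 ≥ 2` is used there.
    rcases hm2.eq_or_lt with rfl | hm3
    · exact Or.inl ⟨hcol, by omega⟩
    · refine Or.inr (lt_of_lt_of_le (Nat.lt_succ_of_le ?_) hr)
      exact Nat.mul_le_mul_right _ (by omega)
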